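/- Let $d\ge 0$ be an integer, let $\|\cdot\|$ be any norm on $\mathbb{R}^d$ with unit sphere $\mathbf{S}=\{x\in\mathbb{R}^d:\|x\|=1\}$, let $\alpha$ be a finite Borel measure on $\mathbf{S}$ and let $\beta:\mathbf{S}\to[0,\infty)$ be Borel measurable. Define a Borel measure $\nu$ on $\mathbb{R}^d$ by $$\nu(E)=\int_{\mathbf{S}}\int_{(0,\infty)}1_E(rv)\,\frac{e^{-\beta(v)r}}{r}\,\mathrm{d}r\,\alpha(\mathrm{d}v),\qquad E\in\mathcal{B}(\mathbb{R}^d).$$ A Borel measure $\nu$ on $\mathbb{R}^d$ is called a Lévy measure if $\nu(\{0\})=0$ and $\int_{\mathbb{R}^d}(|x|^2\wedge 1)\,\nu(\mathrm{d}x)<\infty$, where $|\cdot|$ is the Euclidean norm. A $\Gamma_d(\alpha,\beta)$ distribution is an infinitely divisible probability measure $\mu$ on $\mathbb{R}^d$ such that, for all $z\in\mathbb{R}^d$, $$\int_{\mathbb{R}^d}e^{i z^\top x}\,\mu(\mathrm{d}x)=\exp\left(\int_{\mathbf{S}}\int_{(0,\infty)}\left(e^{irv^\top z}-1\right)\frac{e^{-\beta(v)r}}{r}\,\mathrm{d}r\,\alpha(\mathrm{d}v)\right),$$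 where it is part of the requirement that the inner integral (for $\alpha$-almost every $v$) and the outer integral exist as (absolutely convergent) Lebesgue integrals. Consider the condition $$\int_{\mathbf{S}}\ln\left(1+\frac{1}{\beta(v)}\right)\alpha(\mathrm{d}v)<\infty,\qquad(*)$$ where $\ln(1+1/0)=\infty$. Then: 1. $\nu$ is a Lévy measure if and only if $(*)$ holds. 2. A $\Gamma_d(\alpha,\beta)$ distribution exists if and only if $(*)$ holds. 3. If $(*)$ holds, then $\int_{\mathbb{R}^d}(\|x\|\wedge 1)\,\nu(\mathrm{d}x)<\infty$. -/

import Mathlib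

open MeasureTheory
open scoped ENNReal NNReal

namespace MultivariateGamma

/-- The unit sphere of `ℝ^d` with respect to the (semi)norm `p`. -/
def unitSphere {d : ℕ} (p : Seminorm ℝ (EuclideanSpace ℝ (Fin d))) :
    Set (EuclideanSpace ℝ (Fin d)) :=
  {x | p x = 1}

/-- A Lévy measure on `ℝ^d`: a Borel measure without mass at the origin that integrates
`|x|² ∧ 1`. -/
structure IsLevyMeasure {d : ℕ} (ν : Measure (EuclideanSpace ℝ (Fin d))) : Prop where
  zero : ν {0} = 0
  lintegral_lt_top : ∫⁻ x, ENNReal.ofReal (min (‖x‖ ^ 2) 1) ∂ν < ∞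

/-- `μ` is infinitely divisible: for every `n ≥ 1` it is the law of the sum of `n` independent
random vectors with a common law. -/
def IsInfinitelyDivisible {d : ℕ} (μ : Measure (EuclideanSpace ℝ (Fin d))) : Prop :=
  ∀ n : ℕ, 1 ≤ n → ∃ ρ : Measure (EuclideanSpace ℝ (Fin d)), IsProbabilityMeasure ρ ∧
    μ = (Measure.pi (fun _ : Fin n => ρ)).map (fun x => ∑ i, x i)

/-- The image under `(v, r) ↦ r v` of the measure `(e^{-β(v) r} / r) dr α(dv)` on
`sphere × (0, ∞)`. -/
noncomputable def polarMeasure {d : ℕ} {p : Seminorm ℝ (EuclideanSpace ℝ (Fin d))}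
    (α : Measure (unitSphere p)) (β : unitSphere p → ℝ≥0) :
    Measure (EuclideanSpace ℝ (Fin d)) :=
  ((α.prod (volume.restrict (Set.Ioi (0 : ℝ)))).withDensity
    (fun q => ENNReal.ofReal (Real.exp (-(β q.1 : ℝ) * q.2) / q.2))).map
    (fun q => q.2 • (q.1 : EuclideanSpace ℝ (Fin d)))

/-- The polar formula
`ν(E) = ∫_sphere ∫_(0,∞) 1_E(r v) (e^{-β(v) r} / r) dr α(dv)` for Borel sets `E`. -/
theorem polarMeasure_apply {d : ℕ} {p : Seminorm ℝ (EuclideanSpace ℝ (Fin d))}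
    (α : Measure (unitSphere p)) (β : unitSphere p → ℝ≥0) (hβ : Measurable β)
    {E : Set (EuclideanSpace ℝ (Fin d))} (hE : MeasurableSet E) :
    polarMeasure α β E =
      ∫⁻ v, (∫⁻ r in Set.Ioi (0 : ℝ),
        E.indicator 1 (r • (v : EuclideanSpace ℝ (Fin d))) *
          ENNReal.ofReal (Real.exp (-(β v : ℝ) * r) / r)) ∂α := by
  have hm : Measurable (fun q : unitSphere p × ℝ =>
      q.2 • (q.1 : EuclideanSpace ℝ (Fin d))) := by fun_prop
  have hd : Measurable (fun q : unitSphere p × ℝ =>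
      ENNReal.ofReal (Real.exp (-(β q.1 : ℝ) * q.2) / q.2)) := by fun_prop
  have hi : Measurable (fun q : unitSphere p × ℝ =>
      E.indicator (1 : EuclideanSpace ℝ (Fin d) → ℝ≥0∞)
        (q.2 • (q.1 : EuclideanSpace ℝ (Fin d)))) :=
    (measurable_one.indicator hE).comp hm
  rw [polarMeasure, Measure.map_apply hm hE, withDensity_apply _ (hm hE),
    ← lintegral_indicator (hm hE)]
  refine Eq.trans ?_ (lintegral_prod _ (hi.mul hd).aemeasurable)
  refine lintegral_congr fun q => ?_
  by_cases hq : q.2 • (q.1 : EuclideanSpace ℝ (Fin d)) ∈ E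
  · rw [Set.indicator_of_mem (by exact hq)]
    simp [hq]
  · rw [Set.indicator_of_notMem (by exact hq)]
    simp [hq]

/-- The integrand `(e^{i r vᵀz} - 1) e^{-β(v) r} / r` of the exponent of the Fourier transform,
with `b = β(v)`. -/
noncomputable def fourierIntegrand {d : ℕ} (b : ℝ≥0) (v z : EuclideanSpace ℝ (Fin d)) (r : ℝ) :
    ℂ :=
  (Complex.exp (Complex.I * ((r * inner ℝ v z : ℝ) : ℂ)) - 1) *
    ((Real.exp (-(b : ℝ) * r) / r : ℝ) : ℂ)

/-- `μ` is a `Γ_d(α, β)` distribution: an infinitely divisible probability measure with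
`μ̂(z) = exp (∫_sphere ∫_(0,∞) (e^{i r vᵀz} - 1) (e^{-β(v) r} / r) dr α(dv))` for all `z`,
where the inner integrals (for `α`-almost every `v`) and the outer integral exist as Lebesgue
integrals. -/
structure IsGammaDistribution {d : ℕ} {p : Seminorm ℝ (EuclideanSpace ℝ (Fin d))}
    (α : Measure (unitSphere p)) (β : unitSphere p → ℝ≥0)
    (μ : Measure (EuclideanSpace ℝ (Fin d))) : Prop where
  isProbabilityMeasure : IsProbabilityMeasure μ
  isInfinitelyDivisible : IsInfinitelyDivisible μ
  integrable_inner : ∀ z : EuclideanSpace ℝ (Fin d), ∀ᵐ v ∂α,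
    IntegrableOn (fourierIntegrand (β v) (v : EuclideanSpace ℝ (Fin d)) z) (Set.Ioi 0)
  integrable_outer : ∀ z : EuclideanSpace ℝ (Fin d),
    Integrable (fun v : unitSphere p =>
      ∫ r in Set.Ioi (0 : ℝ), fourierIntegrand (β v) (v : EuclideanSpace ℝ (Fin d)) z r) α
  charFun_eq : ∀ z : EuclideanSpace ℝ (Fin d),
    charFun μ z = Complex.exp (∫ v : unitSphere p,
      (∫ r in Set.Ioi (0 : ℝ), fourierIntegrand (β v) (v : EuclideanSpace ℝ (Fin d)) z r) ∂α)

/-- The integral `∫ ln (1 + 1/β(v)) α(dv)` in `[0, ∞]`, with `1/0 = ∞` and `ln ∞ = ∞`. -/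
noncomputable def logIntegral {d : ℕ} {p : Seminorm ℝ (EuclideanSpace ℝ (Fin d))}
    (α : Measure (unitSphere p)) (β : unitSphere p → ℝ≥0) : ℝ≥0∞ :=
  ∫⁻ v, (ENNReal.log (1 + 1 / (β v : ℝ≥0∞))).toENNReal ∂α

end MultivariateGamma

/-! Everything reduces to a single ray. With `b = β(v)`, the part of `e^{-br}/r` on `(0, 1]` has
bounded integral against `min r 1`, while `∫_1^∞ e^{-br}/r dr` equals `ln (1 + 1/b)` up to constants
(`lintegral_min_le_logTerm`, `logTerm_le_lintegral_min`). Since `α` is finite, additive constants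
are harmless. Hence (*) bounds even the integral of `‖x‖ ∧ 1`, and it already follows from
finiteness of the integral of `|x|² ∧ 1`.

Existence: when `ν` integrates `‖x‖ ∧ 1`, no compensator is needed, and `exp ∫ (e^{i⟨x,z⟩} - 1) dν`
is a limit of compound Poisson characteristic functions (`exists_charFun_eq_exp_jumpExponent`).
Replacing `ν` by `ν/n` gives the `n`-th root.

Necessity: by Frullani, the inner integral has real part `-ln (1 + s²/b²) / 2` with `s = vᵀz`
(`re_integral_rayIntegrand`). Integrability of the exponent at the coordinate vectors therefore
controls `ln (1 + |v|²/b²)`, and `|v|` is bounded below on the sphere. -/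

namespace MultivariateGamma

/-! ### Distributions given by a jump measure that integrates `‖x‖ ∧ 1` -/

section CharFun

open Filter Topology

theorem norm_exp_inner_sub_one_le {E : Type*} [NormedAddCommGroup E] [InnerProductSpace ℝ E]
    (x z : E) :
    ‖Complex.exp ((inner ℝ x z : ℝ) * Complex.I) - 1‖ ≤ (‖z‖ + 2) * min ‖x‖ 1 := by
  have h1 : ‖Complex.exp ((inner ℝ x z : ℝ) * Complex.I) - 1‖ ≤ ‖x‖ * ‖z‖ := by
    rw [mul_comm _ Complex.I]
    exact Real.norm_exp_I_mul_ofReal_sub_one_le.trans (norm_inner_le_norm x z)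
  have h2 : ‖Complex.exp ((inner ℝ x z : ℝ) * Complex.I) - 1‖ ≤ 2 := by
    refine (norm_sub_le _ _).trans ?_
    rw [Complex.norm_exp_ofReal_mul_I, norm_one]
    norm_num
  rcases le_total ‖x‖ 1 with hx | hx
  · rw [min_eq_left hx]
    nlinarith [norm_nonneg x, norm_nonneg z]
  · rw [min_eq_right hx]
    linarith [norm_nonneg z]

variable {E : Type*} [NormedAddCommGroup E] [InnerProductSpace ℝ E] [FiniteDimensional ℝ E]
  [MeasurableSpace E] [BorelSpace E]

/-- A pointwise limit of characteristic functions that is continuous at the origin is a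
characteristic function. -/
theorem exists_charFun_eq_of_tendsto {μ : ℕ → Measure E} [∀ n, IsProbabilityMeasure (μ n)]
    {f : E → ℂ} (hf : ContinuousAt f 0)
    (h : ∀ t, Tendsto (fun n => charFun (μ n) t) atTop (𝓝 (f t))) :
    ∃ ρ : Measure E, IsProbabilityMeasure ρ ∧ ∀ t, charFun ρ t = f t := by
  let P : ℕ → ProbabilityMeasure E := fun n => ⟨μ n, inferInstance⟩
  have htight : IsTightMeasureSet {((ν : ProbabilityMeasure E) : Measure E) | ν ∈ Set.range P} := by
    have := isTightMeasureSet_of_tendsto_charFun hf h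
    convert this using 1
    ext ν
    exact Set.exists_range_iff
  have hcomp := isCompact_closure_of_isTightMeasureSet htight
  -- A cluster point suffices: along an ultrafilter converging to it, the characteristic functions
  -- tend both to its own and to `f`.
  obtain ⟨ρ, -, hρ⟩ := hcomp.exists_mapClusterPt (f := atTop) (u := P)
    (by
      rw [le_principal_iff, mem_map]
      exact Eventually.of_forall fun n => subset_closure (Set.mem_range_self n))
  obtain ⟨U, hU, hlim⟩ := mapClusterPt_iff_ultrafilter.1 hρ
  refine ⟨ρ, inferInstance, fun t => ?_⟩
  have h1 := (ProbabilityMeasure.tendsto_iff_forall_integral_rclike_tendsto ℂ).1 hlim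
    (BoundedContinuousFunction.innerProbChar t)
  simp only [← charFun_eq_integral_innerProbChar] at h1
  exact tendsto_nhds_unique h1 ((h t).mono_left hU)

/-- The integral `∫ (e^{i ⟨x, z⟩} - 1) ν(dx)`. -/
noncomputable def jumpExponent (ν : Measure E) (z : E) : ℂ :=
  ∫ x, (Complex.exp ((inner ℝ x z : ℝ) * Complex.I) - 1) ∂ν

theorem integrable_min_norm_one {ν : Measure E}
    (hν : ∫⁻ x, ENNReal.ofReal (min ‖x‖ 1) ∂ν < ∞) : Integrable (fun x => min ‖x‖ 1) ν := by
  refine ⟨by fun_prop, ?_⟩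
  rw [hasFiniteIntegral_iff_ofReal (Eventually.of_forall fun x => by positivity)]
  exact hν

theorem measurable_exp_inner_sub_one (z : E) :
    Measurable fun x : E => Complex.exp ((inner ℝ x z : ℝ) * Complex.I) - 1 := by
  fun_prop

theorem integrable_exp_inner_sub_one {ν : Measure E}
    (hν : ∫⁻ x, ENNReal.ofReal (min ‖x‖ 1) ∂ν < ∞) (z : E) :
    Integrable (fun x => Complex.exp ((inner ℝ x z : ℝ) * Complex.I) - 1) ν :=
  ((integrable_min_norm_one hν).const_mul (‖z‖ + 2)).mono'
    (measurable_exp_inner_sub_one z).aestronglyMeasurable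
    (Eventually.of_forall fun x => norm_exp_inner_sub_one_le x z)

theorem continuousAt_jumpExponent {ν : Measure E}
    (hν : ∫⁻ x, ENNReal.ofReal (min ‖x‖ 1) ∂ν < ∞) : ContinuousAt (jumpExponent ν) 0 := by
  refine continuousAt_of_dominated (bound := fun x => 3 * min ‖x‖ 1)
    (Eventually.of_forall fun z => (measurable_exp_inner_sub_one z).aestronglyMeasurable) ?_
    ((integrable_min_norm_one hν).const_mul 3) (Eventually.of_forall fun x => by fun_prop)
  filter_upwards [Metric.ball_mem_nhds (0 : E) one_pos] with z hz
  refine Eventually.of_forall fun x => (norm_exp_inner_sub_one_le x z).trans ?_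
  have : ‖z‖ ≤ 1 := (mem_ball_zero_iff.1 hz).le
  gcongr
  linarith

theorem jumpExponent_eq_charFun_sub (ν : Measure E) [IsFiniteMeasure ν] (z : E) :
    jumpExponent ν z = charFun ν z - ν.real Set.univ := by
  rw [jumpExponent, integral_sub ?_ (integrable_const _), charFun_apply]
  · simp
  · refine (integrable_const (1 : ℝ)).mono' (by fun_prop) (Eventually.of_forall fun x => ?_)
    rw [Complex.norm_exp_ofReal_mul_I]

/-- The compound Poisson distribution with a finite jump measure. -/
theorem exists_charFun_eq_exp_of_isFiniteMeasure (ν : Measure E) [IsFiniteMeasure ν] :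
    ∃ ρ : Measure E, IsProbabilityMeasure ρ ∧
      ∀ z, charFun ρ z = Complex.exp (jumpExponent ν z) := by
  have hν : ∫⁻ x, ENNReal.ofReal (min ‖x‖ 1) ∂ν < ∞ := by
    refine lt_of_le_of_lt (lintegral_mono (g := fun _ => 1) fun x => ?_) (by simp)
    exact ENNReal.ofReal_le_one.2 (min_le_right _ _)
  let m : ℝ := ν.real Set.univ
  obtain ⟨N, hN⟩ := exists_nat_gt m
  have hm : 0 ≤ m := measureReal_nonneg
  -- Starting beyond `N > m` makes `1 - m / k n` nonnegative, so `π n`, which jumps with probability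
  -- `m / k n`, is a probability measure. Its `k n`-fold convolution has characteristic function `(1
  -- + ψ / k n) ^ k n`, where `ψ` is the jump exponent.
  let k : ℕ → ℝ := fun n => ((n + N + 1 : ℕ) : ℝ)
  have hk : ∀ n, 0 < k n := fun n => by positivity
  have hmk : ∀ n, m ≤ k n := fun n => by
    simp only [k]; push_cast; linarith [(Nat.cast_nonneg n : (0 : ℝ) ≤ n)]
  let π : ℕ → Measure E := fun n =>
    ENNReal.ofReal (1 - m / k n) • Measure.dirac 0 + ENNReal.ofReal (k n)⁻¹ • ν
  have hmk' : ∀ n, 0 ≤ 1 - m / k n := fun n => by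
    rw [sub_nonneg, div_le_one (hk n)]; exact hmk n
  have hπ : ∀ n, IsProbabilityMeasure (π n) := fun n => ⟨by
    have h1 : ν Set.univ = ENNReal.ofReal m := (ofReal_measureReal).symm
    simp only [π, Measure.add_apply, Measure.smul_apply, smul_eq_mul, measure_univ, mul_one, h1]
    rw [← ENNReal.ofReal_mul (by have := hk n; positivity),
      ← ENNReal.ofReal_add (hmk' n) (by have := hk n; positivity)]
    rw [← ENNReal.ofReal_one]
    congr 1
    have := (hk n).ne'
    field_simp
    ring⟩
  have hexp : ∀ (σ : Measure E) [IsFiniteMeasure σ] (z : E),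
      Integrable (fun x => Complex.exp ((inner ℝ x z : ℝ) * Complex.I)) σ := fun σ _ z => by
    refine (integrable_const (1 : ℝ)).mono' (by fun_prop) (Eventually.of_forall fun x => ?_)
    rw [Complex.norm_exp_ofReal_mul_I]
  have hcf : ∀ n z, charFun (π n) z = 1 + jumpExponent ν z / k n := fun n z => by
    rw [jumpExponent_eq_charFun_sub, charFun_apply]
    simp only [π]
    rw [integral_add_measure ((hexp _ z).smul_measure ENNReal.ofReal_ne_top)
      ((hexp _ z).smul_measure ENNReal.ofReal_ne_top), integral_smul_measure,
      integral_smul_measure, integral_dirac, ← charFun_apply,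
      ENNReal.toReal_ofReal (hmk' n), ENNReal.toReal_ofReal (by have := hk n; positivity)]
    simp only [inner_zero_left, Complex.ofReal_zero, zero_mul, Complex.exp_zero, Complex.real_smul]
    have : (k n : ℂ) ≠ 0 := Complex.ofReal_ne_zero.2 (hk n).ne'
    push_cast
    field_simp
    simp only [m]
    ring
  let μ : ℕ → Measure E := fun n =>
    (Measure.pi (fun _ : Fin (n + N + 1) => π n)).map (fun x => ∑ i, x i)
  have hμ : ∀ n, IsProbabilityMeasure (μ n) := fun n =>
    Measure.isProbabilityMeasure_map (by fun_prop)
  refine exists_charFun_eq_of_tendsto (μ := μ)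
    (Complex.continuous_exp.continuousAt.comp (continuousAt_jumpExponent hν)) fun z => ?_
  have hlim := (Complex.tendsto_one_add_div_pow_exp (jumpExponent ν z)).comp
    (tendsto_add_atTop_nat (N + 1))
  refine hlim.congr fun n => ?_
  simp only [μ, ProbabilityTheory.charFun_map_sum_pi_eq_prod, Finset.prod_apply,
    Finset.prod_const, hcf]
  simp [k, add_assoc]

/-- The distribution without drift and Gaussian part whose jump measure integrates
`‖x‖ ∧ 1`. -/
theorem exists_charFun_eq_exp_jumpExponent {ν : Measure E}
    (hν : ∫⁻ x, ENNReal.ofReal (min ‖x‖ 1) ∂ν < ∞) :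
    ∃ ρ : Measure E, IsProbabilityMeasure ρ ∧
      ∀ z, charFun ρ z = Complex.exp (jumpExponent ν z) := by
  -- These sets have finite mass by Markov's inequality and exhaust the complement of the origin,
  -- where the integrand vanishes.
  let S : ℕ → Set E := fun n => {x | 1 / ((n : ℝ) + 1) ≤ min ‖x‖ 1}
  have hS : ∀ n, MeasurableSet (S n) := fun n =>
    measurableSet_le measurable_const (by fun_prop)
  have hfin : ∀ n, IsFiniteMeasure (ν.restrict (S n)) := fun n => ⟨by
    rw [Measure.restrict_apply_univ]
    have hpos : (0 : ℝ) < 1 / ((n : ℝ) + 1) := by positivity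
    exact (integrable_min_norm_one hν).measure_ge_lt_top hpos⟩
  choose μ hμ hμc using fun n => exists_charFun_eq_exp_of_isFiniteMeasure (ν.restrict (S n))
  refine exists_charFun_eq_of_tendsto (μ := μ)
    (Complex.continuous_exp.continuousAt.comp (continuousAt_jumpExponent hν)) fun z => ?_
  simp only [hμc]
  refine (Complex.continuous_exp.tendsto _).comp ?_
  simp only [jumpExponent, ← integral_indicator (hS _)]
  refine tendsto_integral_of_dominated_convergence (fun x => (‖z‖ + 2) * min ‖x‖ 1)
    (fun n => ((measurable_exp_inner_sub_one z).indicator (hS n)).aestronglyMeasurable)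
    ((integrable_min_norm_one hν).const_mul _) (fun n => Eventually.of_forall fun x => ?_)
    (Eventually.of_forall fun x => ?_)
  · exact (norm_indicator_le_norm_self _ _).trans (norm_exp_inner_sub_one_le x z)
  · rcases eq_or_ne x 0 with rfl | hx
    · simp [Set.indicator]
    · refine tendsto_const_nhds.congr' ?_
      have hpos : 0 < min ‖x‖ 1 := lt_min (norm_pos_iff.2 hx) one_pos
      filter_upwards [tendsto_one_div_add_atTop_nhds_zero_nat.eventually (gt_mem_nhds hpos)]
        with n hn
      rw [Set.indicator_of_mem (show x ∈ S n from le_of_lt hn)]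

end CharFun

/-! ### Logarithmic bounds along one ray -/

section RealIntegrals

open Filter Topology Set

/-- `ln (1 + 1/b)` in `[0, ∞]`. -/
noncomputable def logTerm (b : ℝ≥0) : ℝ≥0∞ :=
  (ENNReal.log (1 + 1 / (b : ℝ≥0∞))).toENNReal

theorem logTerm_zero : logTerm 0 = ∞ := by
  simp [logTerm]

theorem logTerm_of_ne_zero {b : ℝ≥0} (hb : b ≠ 0) :
    logTerm b = ENNReal.ofReal (Real.log (1 + 1 / (b : ℝ))) := by
  have h : (1 + 1 / (b : ℝ≥0∞)) = ENNReal.ofReal (1 + 1 / (b : ℝ)) := by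
    rw [ENNReal.ofReal_add zero_le_one (by positivity), ENNReal.ofReal_div_of_pos
      (by exact_mod_cast pos_iff_ne_zero.2 hb)]
    simp
  rw [logTerm, h, ENNReal.log_ofReal_of_pos (by positivity), EReal.toENNReal_of_ne_top (by simp)]
  simp

/-- Split `1/r = 1/(r(1+br)) + b/(1+br)`. Bounding `e^{-br}` by `1` in the first piece and
`1/(1+br)` by `1` in the second leaves an integrand with an explicit primitive. -/
theorem integral_tail_le {b : ℝ} (hb : 0 < b) :
    ∫⁻ r in Ioi (1 : ℝ), ENNReal.ofReal (Real.exp (-b * r) / r)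
      ≤ ENNReal.ofReal (1 + Real.log (1 + 1 / b)) := by
  have hd : ∀ r ∈ Ici (1 : ℝ), HasDerivAt
      (fun r => Real.log (r / (1 + b * r)) - Real.exp (-b * r))
      (1 / (r * (1 + b * r)) + b * Real.exp (-b * r)) r := fun r hr => by
    have hr0 : 0 < r := lt_of_lt_of_le one_pos hr
    have hbr : 1 + b * r ≠ 0 := by positivity
    have h1 : HasDerivAt (fun r : ℝ => 1 + b * r) b r := by
      simpa using ((hasDerivAt_id r).const_mul b).const_add 1
    have h2 := ((hasDerivAt_id r).div h1 hbr).log (div_ne_zero hr0.ne' hbr)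
    have h3 : HasDerivAt (fun r : ℝ => -b * r) (-b) r := by
      simpa using (hasDerivAt_id r).const_mul (-b)
    refine (h2.sub h3.exp).congr_deriv ?_
    simp only [id, Pi.div_apply]
    field_simp
    ring
  have hnn : ∀ r ∈ Ioi (1 : ℝ), 0 ≤ 1 / (r * (1 + b * r)) + b * Real.exp (-b * r) :=
    fun r hr => by
      have hr0 : 0 < r := lt_trans one_pos hr
      positivity
  have hlim : Tendsto (fun r => Real.log (r / (1 + b * r)) - Real.exp (-b * r)) atTop
      (𝓝 (Real.log (1 / b) - 0)) := by
    refine Tendsto.sub ?_ ?_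
    · have h1 : Tendsto (fun r : ℝ => 1 / (r⁻¹ + b)) atTop (𝓝 (1 / (0 + b))) :=
        tendsto_const_nhds.div (tendsto_inv_atTop_zero.add_const b) (by simpa using hb.ne')
      rw [zero_add] at h1
      refine (h1.log (by positivity)).congr' ?_
      filter_upwards [eventually_gt_atTop 0] with r hr
      congr 1
      field_simp
    · refine Real.tendsto_exp_atBot.comp ?_
      exact tendsto_id.const_mul_atTop_of_neg (neg_lt_zero.2 hb)
  have hint := integrableOn_Ioi_deriv_of_nonneg' hd hnn hlim
  have heq := integral_Ioi_of_hasDerivAt_of_nonneg' hd hnn hlim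
  calc ∫⁻ r in Ioi (1 : ℝ), ENNReal.ofReal (Real.exp (-b * r) / r)
      ≤ ∫⁻ r in Ioi (1 : ℝ), ENNReal.ofReal (1 / (r * (1 + b * r)) + b * Real.exp (-b * r)) := by
        refine setLIntegral_mono' measurableSet_Ioi fun r hr => ENNReal.ofReal_le_ofReal ?_
        have hr0 : 0 < r := lt_trans one_pos hr
        have he : Real.exp (-b * r) ≤ 1 := Real.exp_le_one_iff.2 (by nlinarith)
        have hsplit : Real.exp (-b * r) / r =
            Real.exp (-b * r) / (r * (1 + b * r)) + b * Real.exp (-b * r) / (1 + b * r) := by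
          field_simp
        rw [hsplit]
        refine add_le_add (by gcongr) (div_le_self (by positivity) ?_)
        nlinarith
    _ = ENNReal.ofReal (Real.log (1 / b) - 0 -
          (Real.log (1 / (1 + b * 1)) - Real.exp (-b * 1))) := by
        rw [← ofReal_integral_eq_lintegral_ofReal hint
          ((ae_restrict_iff' measurableSet_Ioi).2 (Eventually.of_forall hnn)), heq]
    _ ≤ _ := by
        refine ENNReal.ofReal_le_ofReal ?_
        have he : Real.exp (-b * 1) ≤ 1 := Real.exp_le_one_iff.2 (by linarith)
        have h1 : Real.log (1 + 1 / b) = Real.log (1 / b) - Real.log (1 / (1 + b * 1)) := by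
          rw [← Real.log_div (by positivity) (by positivity)]
          congr 1
          field_simp
          ring
        rw [h1]
        linarith

/-- The mass that truncated linear growth gets from one ray is at most `2 + ln (1 + 1/b)`. -/
theorem lintegral_min_le_logTerm (b : ℝ≥0) :
    ∫⁻ r in Ioi (0 : ℝ), ENNReal.ofReal (min r 1) *
      ENNReal.ofReal (Real.exp (-(b : ℝ) * r) / r) ≤ 2 + logTerm b := by
  rcases eq_or_ne b 0 with rfl | hb
  · simp [logTerm_zero]
  have hb0 : (0 : ℝ) < b := by exact_mod_cast pos_iff_ne_zero.2 hb
  rw [← Ioc_union_Ioi_eq_Ioi (zero_le_one (α := ℝ)),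
    lintegral_union measurableSet_Ioi (Ioc_disjoint_Ioi le_rfl)]
  have h1 : ∫⁻ r in Ioc (0 : ℝ) 1, ENNReal.ofReal (min r 1) *
      ENNReal.ofReal (Real.exp (-(b : ℝ) * r) / r) ≤ 1 := by
    calc _ ≤ ∫⁻ _ in Ioc (0 : ℝ) 1, (1 : ℝ≥0∞) := by
          refine setLIntegral_mono' measurableSet_Ioc fun r hr => ?_
          have hr0 := hr.1
          rw [min_eq_left hr.2, ← ENNReal.ofReal_mul hr0.le, ENNReal.ofReal_le_one,
            mul_div_cancel₀ _ hr0.ne', Real.exp_le_one_iff]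
          nlinarith
      _ = 1 := by simp
  have h2 : ∫⁻ r in Ioi (1 : ℝ), ENNReal.ofReal (min r 1) *
      ENNReal.ofReal (Real.exp (-(b : ℝ) * r) / r) ≤ 1 + logTerm b := by
    rw [logTerm_of_ne_zero hb]
    refine le_trans (setLIntegral_mono' measurableSet_Ioi fun r hr => ?_)
      ((integral_tail_le hb0).trans ENNReal.ofReal_add_le |>.trans_eq (by simp))
    rw [min_eq_right (le_of_lt hr)]
    simp
  calc _ ≤ 1 + (1 + logTerm b) := add_le_add h1 h2
    _ = 2 + logTerm b := by rw [← add_assoc, one_add_one_eq_two]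

/-- On `(1, T]` the exponential is at least `1/e`, and `1/r` integrates to `ln T`. The free `T`
serves both `b = 0` (arbitrarily large `T`) and `b ≤ 1` (`T = 1/b`). -/
theorem log_le_lintegral_tail {b T : ℝ} (hT : 1 ≤ T) (hbT : b * T ≤ 1) (hb : 0 ≤ b) :
    ENNReal.ofReal (Real.log T) ≤ ENNReal.ofReal (Real.exp 1) *
      ∫⁻ r in Ioi (1 : ℝ), ENNReal.ofReal (Real.exp (-b * r) / r) := by
  have hT0 : 0 < T := by linarith
  have hint : IntegrableOn (fun r : ℝ => 1 / r) (Ioc 1 T) := by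
    have := (intervalIntegral.intervalIntegrable_one_div (a := 1) (b := T) (μ := volume)
      (f := fun r => r) (fun r hr => by
        rw [uIcc_of_le hT] at hr
        linarith [hr.1]) continuousOn_id)
    exact (intervalIntegrable_iff_integrableOn_Ioc_of_le hT).1 this
  have hval : ∫ r in Ioc (1 : ℝ) T, 1 / r = Real.log T := by
    rw [← intervalIntegral.integral_of_le hT, integral_one_div_of_pos one_pos hT0, div_one]
  rw [← hval, ofReal_integral_eq_lintegral_ofReal hint
    ((ae_restrict_iff' measurableSet_Ioc).2 (Eventually.of_forall fun r hr => by
      have : 0 < r := by linarith [hr.1]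
      simp only [Pi.zero_apply]
      positivity)), ← lintegral_const_mul' _ _ ENNReal.ofReal_ne_top]
  refine (setLIntegral_mono' measurableSet_Ioc fun r hr => ?_).trans
    (lintegral_mono_set Ioc_subset_Ioi_self)
  have hr0 : 0 < r := by linarith [hr.1]
  rw [← ENNReal.ofReal_mul (Real.exp_pos 1).le, ← mul_div_assoc, ← Real.exp_add]
  refine ENNReal.ofReal_le_ofReal ?_
  gcongr
  refine Real.one_le_exp ?_
  linarith [mul_le_mul_of_nonneg_left hr.2 hb]

theorem logTerm_le_lintegral_tail (b : ℝ≥0) :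
    logTerm b ≤ 1 + ENNReal.ofReal (Real.exp 1) *
      ∫⁻ r in Ioi (1 : ℝ), ENNReal.ofReal (Real.exp (-(b : ℝ) * r) / r) := by
  rcases eq_or_ne b 0 with rfl | hb
  · refine le_of_eq_of_le logTerm_zero (le_of_eq_of_le ?_ le_add_self)
    refine (ENNReal.eq_top_of_forall_nnreal_le fun x => ?_).symm
    have := log_le_lintegral_tail (b := 0) (T := Real.exp x) (Real.one_le_exp x.2) (by simp) le_rfl
    rwa [Real.log_exp, ENNReal.ofReal_coe_nnreal] at this
  have hb0 : (0 : ℝ) < b := by exact_mod_cast pos_iff_ne_zero.2 hb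
  rw [logTerm_of_ne_zero hb]
  -- The additive `1` absorbs `ln 2`: `1 + 1/b` is at most `2` for `b ≥ 1` and at most `2/b` for `b
  -- ≤ 1`.
  have hlog2 : Real.log 2 ≤ 1 := by linarith [Real.log_two_lt_d9]
  rcases le_total (1 : ℝ) b with h1 | h1
  · refine le_add_right (ENNReal.ofReal_le_one.2 (le_trans (Real.log_le_log (by positivity) ?_) hlog2))
    have : 1 / (b : ℝ) ≤ 1 := (div_le_one hb0).2 h1
    linarith
  · have h1b : 1 ≤ 1 / (b : ℝ) := (one_le_div hb0).2 h1
    refine le_trans (ENNReal.ofReal_le_ofReal (q := 1 + Real.log (1 / b)) ?_)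
      (ENNReal.ofReal_add_le.trans ?_)
    · refine (Real.log_le_log (by positivity) (?_ : _ ≤ 2 * (1 / (b : ℝ)))).trans ?_
      · linarith
      · rw [Real.log_mul two_ne_zero (by positivity)]
        linarith
    · rw [ENNReal.ofReal_one]
      gcongr
      exact log_le_lintegral_tail h1b (by field_simp; exact le_rfl) hb0.le

/-- `ln (1 + 1/b)` is controlled by the mass that truncated quadratic growth gets from one ray. -/
theorem logTerm_le_lintegral_min {c : ℝ} (hc : 0 < c) (b : ℝ≥0) :
    logTerm b ≤ 1 + ENNReal.ofReal (Real.exp 1 / min (c ^ 2) 1) *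
      ∫⁻ r in Ioi (0 : ℝ), ENNReal.ofReal (min ((r * c) ^ 2) 1) *
        ENNReal.ofReal (Real.exp (-(b : ℝ) * r) / r) := by
  refine (logTerm_le_lintegral_tail b).trans ?_
  have hk : 0 < min (c ^ 2) 1 := by positivity
  refine add_le_add le_rfl ?_
  rw [div_eq_mul_inv, ENNReal.ofReal_mul (Real.exp_pos 1).le, mul_assoc]
  refine mul_le_mul' le_rfl ?_
  rw [← lintegral_const_mul' _ _ ENNReal.ofReal_ne_top]
  -- Only `r > 1` is kept, where `min ((rc)²) 1 ≥ min (c²) 1`.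
  refine le_trans (setLIntegral_mono' measurableSet_Ioi fun r hr => ?_)
    (lintegral_mono_set (Ioi_subset_Ioi zero_le_one))
  rw [← mul_assoc, ← ENNReal.ofReal_mul (by positivity)]
  refine le_mul_of_one_le_left zero_le (ENNReal.one_le_ofReal.2 ?_)
  rw [← div_eq_inv_mul, one_le_div hk]
  refine min_le_min_right _ ?_
  have hr1 : 1 ≤ r := le_of_lt hr
  gcongr
  exact le_mul_of_one_le_left hc.le hr1

end RealIntegrals

/-! ### The Frullani integral along one ray -/

section InnerIntegral

open Filter Topology Set

/-- The integrand of the exponent along a ray, with `s` in place of `vᵀz`. -/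
noncomputable def rayIntegrand (b s r : ℝ) : ℂ :=
  (Complex.exp (Complex.I * ((r * s : ℝ) : ℂ)) - 1) * ((Real.exp (-b * r) / r : ℝ) : ℂ)

theorem measurable_rayIntegrand (b s : ℝ) : Measurable (rayIntegrand b s) := by
  unfold rayIntegrand
  fun_prop

theorem norm_rayIntegrand_le {b s r : ℝ} (hr : 0 < r) :
    ‖rayIntegrand b s r‖ ≤ |s| * Real.exp (-b * r) := by
  rw [rayIntegrand, norm_mul, Complex.norm_real, Real.norm_of_nonneg (by positivity)]
  calc _ ≤ ‖r * s‖ * (Real.exp (-b * r) / r) := by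
        gcongr
        exact Real.norm_exp_I_mul_ofReal_sub_one_le
    _ = _ := by
        rw [norm_mul, Real.norm_of_nonneg hr.le, Real.norm_eq_abs]
        field_simp

theorem integrableOn_rayIntegrand {b : ℝ} (hb : 0 < b) (s : ℝ) :
    IntegrableOn (rayIntegrand b s) (Ioi 0) := by
  refine ((integrableOn_exp_mul_Ioi (neg_lt_zero.2 hb) 0).const_mul |s|).mono'
    (measurable_rayIntegrand b s).aestronglyMeasurable ?_
  exact (ae_restrict_iff' measurableSet_Ioi).2 (Eventually.of_forall fun r hr =>
    norm_rayIntegrand_le hr)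

/-- Differentiation in `s` cancels the factor `1/r` and leaves a plain exponential integral. -/
theorem hasDerivAt_integral_rayIntegrand {b : ℝ} (hb : 0 < b) (s : ℝ) :
    HasDerivAt (fun s => ∫ r in Ioi (0 : ℝ), rayIntegrand b s r)
      (Complex.I / (b - Complex.I * s)) s := by
  have hre : (Complex.I * s - b : ℂ).re < 0 := by simpa using hb
  have hF' : ∀ (s r : ℝ), Complex.I * Complex.exp ((Complex.I * s - b) * r) =
      Complex.I * Complex.exp (Complex.I * ((r * s : ℝ) : ℂ)) * (Real.exp (-b * r) : ℝ) := by
    intro s r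
    rw [Complex.ofReal_exp, mul_assoc, ← Complex.exp_add]
    congr 2
    push_cast
    ring
  have h := (hasDerivAt_integral_of_dominated_loc_of_deriv_le
    (μ := volume.restrict (Ioi (0 : ℝ))) (F := fun s r => rayIntegrand b s r) (x₀ := s)
    (F' := fun s r => Complex.I * Complex.exp ((Complex.I * s - b) * r))
    (bound := fun r => Real.exp (-b * r)) univ_mem
    (Eventually.of_forall fun s => (measurable_rayIntegrand b s).aestronglyMeasurable)
    (integrableOn_rayIntegrand hb s) (by fun_prop) ?_
    (integrableOn_exp_mul_Ioi (neg_lt_zero.2 hb) 0) ?_).2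
  · refine h.congr_deriv ?_
    rw [integral_const_mul, integral_exp_mul_complex_Ioi hre]
    have h1 : (Complex.I * s - b : ℂ) ≠ 0 := fun h => by simp [h] at hre
    have h2 : (b - Complex.I * s : ℂ) ≠ 0 := fun h => h1 (by rw [← neg_sub, h, neg_zero])
    simp only [Complex.ofReal_zero, mul_zero, Complex.exp_zero]
    field_simp
    ring
  · refine Eventually.of_forall fun r s _ => ?_
    rw [hF', norm_mul, norm_mul, Complex.norm_I, Complex.norm_exp_I_mul_ofReal, Complex.norm_real,
      Real.norm_of_nonneg (Real.exp_pos _).le, one_mul, one_mul]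
  · refine (ae_restrict_iff' measurableSet_Ioi).2 (Eventually.of_forall fun r hr s _ => ?_)
    have hr0 : (r : ℂ) ≠ 0 := Complex.ofReal_ne_zero.2 (ne_of_gt hr)
    have h1 : HasDerivAt (fun s : ℝ => Complex.I * ((r * s : ℝ) : ℂ)) (Complex.I * (r : ℂ)) s := by
      have := ((hasDerivAt_id s).const_mul r).ofReal_comp.const_mul Complex.I
      simpa using this
    refine ((h1.cexp.sub_const 1).mul_const _).congr_deriv ?_
    rw [hF']
    push_cast
    field_simp

/-- Frullani's formula `∫ (1 - cos (r s)) e^{-b r} / r dr = ln (1 + s² / b²) / 2`. -/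
theorem re_integral_rayIntegrand {b : ℝ} (hb : 0 < b) (s : ℝ) :
    (∫ r in Ioi (0 : ℝ), rayIntegrand b s r).re = -(Real.log (1 + s ^ 2 / b ^ 2) / 2) := by
  -- The two sides agree at `s = 0`, so it is enough that their difference has zero derivative.
  have hd : ∀ s : ℝ, HasDerivAt (fun s => (∫ r in Ioi (0 : ℝ), rayIntegrand b s r).re +
      Real.log (1 + s ^ 2 / b ^ 2) / 2) 0 s := fun s => by
    have h1 := (Complex.reCLM.hasFDerivAt.comp_hasDerivAt s (hasDerivAt_integral_rayIntegrand hb s))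
    have h2 : HasDerivAt (fun s : ℝ => 1 + s ^ 2 / b ^ 2) (2 * s / b ^ 2) s := by
      simpa using ((hasDerivAt_pow 2 s).div_const (b ^ 2)).const_add 1
    have hpos : (1 + s ^ 2 / b ^ 2) ≠ 0 := by positivity
    refine (h1.add ((h2.log hpos).div_const 2)).congr_deriv ?_
    have hn : Complex.normSq (b - Complex.I * s) = b ^ 2 + s ^ 2 := by
      simp [Complex.normSq_apply]; ring
    simp only [Complex.reCLM_apply, Complex.div_re, hn]
    simp
    have : b ^ 2 + s ^ 2 ≠ 0 := by positivity
    field_simp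
    ring
  have := is_const_of_deriv_eq_zero (fun s => (hd s).differentiableAt) (fun s => (hd s).deriv) s 0
  simp [rayIntegrand] at this
  simp only [rayIntegrand]
  push_cast
  simp
  linarith

/-- The integrand for `b = 0` dominates in norm those for all `b > 0`, whose integrals have real
parts unbounded as `b → 0` by Frullani. -/
theorem not_integrableOn_rayIntegrand_zero {s : ℝ} (hs : s ≠ 0) :
    ¬ IntegrableOn (rayIntegrand 0 s) (Ioi 0) := fun hint => by
  let M := ∫ r in Ioi (0 : ℝ), ‖rayIntegrand 0 s r‖
  have hM : 0 ≤ M := integral_nonneg fun _ => norm_nonneg _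
  have hle : ∀ b : ℝ, 0 < b → Real.log (1 + s ^ 2 / b ^ 2) / 2 ≤ M := fun b hb => by
    rw [← neg_neg (_ / 2), ← re_integral_rayIntegrand hb]
    refine (neg_le_abs _).trans ((Complex.abs_re_le_norm _).trans ?_)
    refine norm_integral_le_of_norm_le hint.norm ?_
    refine (ae_restrict_iff' measurableSet_Ioi).2 (Eventually.of_forall fun r hr => ?_)
    have hr0 : 0 < r := hr
    simp only [rayIntegrand, norm_mul, Complex.norm_real]
    gcongr
    rw [Real.norm_of_nonneg (by positivity), Real.norm_of_nonneg (by positivity)]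
    gcongr
  have hs2 : 0 < |s| := abs_pos.2 hs
  -- This `b` makes `s²/b² = e^{2(M+1)}`, which would force `M + 1 ≤ M`.
  have h := hle (|s| * Real.exp (-(M + 1))) (by positivity)
  have h2 : s ^ 2 / (|s| * Real.exp (-(M + 1))) ^ 2 = Real.exp (2 * (M + 1)) := by
    rw [mul_pow, sq_abs, ← Real.exp_nat_mul, div_mul_eq_div_div, div_self (by positivity),
      one_div, ← Real.exp_neg]
    congr 1
    push_cast
    ring
  rw [h2] at h
  have h3 : 2 * (M + 1) ≤ Real.log (1 + Real.exp (2 * (M + 1))) := by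
    rw [Real.le_log_iff_exp_le (by positivity)]
    linarith
  linarith

end InnerIntegral

/-! ### The polar measure and its Gamma distributions -/

section Polar

open Filter Topology Set

variable {d : ℕ} {p : Seminorm ℝ (EuclideanSpace ℝ (Fin d))}

theorem seminorm_continuous (p : Seminorm ℝ (EuclideanSpace ℝ (Fin d))) : Continuous p :=
  continuousOn_univ.1 (p.convexOn.continuousOn isOpen_univ)

theorem exists_norm_le_seminorm (hp : ∀ x : EuclideanSpace ℝ (Fin d), p x = 0 → x = 0) :
    ∃ C : ℝ, 0 < C ∧ ∀ x, ‖x‖ ≤ C * p x := by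
  -- The sphere is empty when `d = 0`; otherwise `p` attains a positive minimum on it by
  -- compactness.
  rcases (Metric.sphere (0 : EuclideanSpace ℝ (Fin d)) 1).eq_empty_or_nonempty with he | hne
  · refine ⟨1, one_pos, fun x => ?_⟩
    rcases eq_or_ne x 0 with rfl | hx
    · simp
    · have : ‖x‖⁻¹ • x ∈ Metric.sphere (0 : EuclideanSpace ℝ (Fin d)) 1 := by
        simp [norm_smul, hx]
      simp [he] at this
  obtain ⟨y, hy, hmin⟩ := (isCompact_sphere (0 : EuclideanSpace ℝ (Fin d)) 1).exists_isMinOn hne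
    (seminorm_continuous p).continuousOn
  have hy1 : ‖y‖ = 1 := by simpa using hy
  have hpos : 0 < p y := lt_of_le_of_ne (apply_nonneg p y) fun h => by
    rw [hp y h.symm, norm_zero] at hy1
    exact zero_ne_one hy1
  refine ⟨(p y)⁻¹, inv_pos.2 hpos, fun x => ?_⟩
  rcases eq_or_ne x 0 with rfl | hx
  · simp
  have hx0 : 0 < ‖x‖ := norm_pos_iff.2 hx
  have h : p y ≤ p (‖x‖⁻¹ • x) :=
    hmin (show ‖x‖⁻¹ • x ∈ Metric.sphere 0 1 by simp [norm_smul, hx])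
  rw [map_smul_eq_mul, norm_inv, norm_norm, ← div_eq_inv_mul, le_div_iff₀ hx0] at h
  rw [← div_eq_inv_mul, le_div_iff₀ hpos]
  linarith

theorem exists_le_norm_unitSphere (p : Seminorm ℝ (EuclideanSpace ℝ (Fin d))) :
    ∃ c : ℝ, 0 < c ∧ ∀ v : unitSphere p, c ≤ ‖(v : EuclideanSpace ℝ (Fin d))‖ := by
  obtain ⟨K, hK, h⟩ := p.bound_of_continuous_normedSpace (seminorm_continuous p)
  refine ⟨K⁻¹, inv_pos.2 hK, fun v => ?_⟩
  have hv : p v = 1 := v.2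
  rw [inv_le_iff_one_le_mul₀ hK, ← hv, mul_comm]
  exact h v

theorem lintegral_polarMeasure (α : Measure (unitSphere p)) (β : unitSphere p → ℝ≥0)
    (hβ : Measurable β) {f : EuclideanSpace ℝ (Fin d) → ℝ≥0∞} (hf : Measurable f) :
    ∫⁻ x, f x ∂(polarMeasure α β) = ∫⁻ v, (∫⁻ r in Ioi (0 : ℝ),
      f (r • (v : EuclideanSpace ℝ (Fin d))) *
        ENNReal.ofReal (Real.exp (-(β v : ℝ) * r) / r)) ∂α := by
  have hm : Measurable (fun q : unitSphere p × ℝ =>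
      q.2 • (q.1 : EuclideanSpace ℝ (Fin d))) := by fun_prop
  have hd : Measurable (fun q : unitSphere p × ℝ =>
      ENNReal.ofReal (Real.exp (-(β q.1 : ℝ) * q.2) / q.2)) := by fun_prop
  rw [polarMeasure, lintegral_map hf hm]
  exact (lintegral_withDensity_eq_lintegral_mul _ hd (hf.comp hm)).trans
    ((lintegral_congr fun q => mul_comm _ _).trans
      (lintegral_prod _ ((hf.comp hm).mul hd).aemeasurable))

theorem lintegral_min_seminorm_le (α : Measure (unitSphere p)) (β : unitSphere p → ℝ≥0)
    (hβ : Measurable β) :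
    ∫⁻ x, ENNReal.ofReal (min (p x) 1) ∂(polarMeasure α β) ≤ 2 * α univ + logIntegral α β := by
  have hpm : Measurable p := (seminorm_continuous p).measurable
  rw [lintegral_polarMeasure α β hβ (by fun_prop)]
  calc _ ≤ ∫⁻ v, (2 + logTerm (β v)) ∂α := by
        refine lintegral_mono fun v => le_trans (le_of_eq ?_) (lintegral_min_le_logTerm (β v))
        refine setLIntegral_congr_fun measurableSet_Ioi fun r hr => ?_
        have hv : p v = 1 := v.2
        have hr0 : 0 < r := hr
        simp only [map_smul_eq_mul, hv, mul_one, Real.norm_of_nonneg hr0.le]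
    _ = _ := by
        rw [lintegral_add_left measurable_const, lintegral_const]
        rfl

theorem lintegral_min_norm_lt_top (hp : ∀ x : EuclideanSpace ℝ (Fin d), p x = 0 → x = 0)
    (α : Measure (unitSphere p)) [IsFiniteMeasure α] (β : unitSphere p → ℝ≥0)
    (hβ : Measurable β) (h : logIntegral α β < ∞) :
    ∫⁻ x, ENNReal.ofReal (min ‖x‖ 1) ∂(polarMeasure α β) < ∞ := by
  obtain ⟨C, hC, hle⟩ := exists_norm_le_seminorm hp
  calc _ ≤ ∫⁻ x, ENNReal.ofReal (C + 1) * ENNReal.ofReal (min (p x) 1) ∂(polarMeasure α β) := by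
        refine lintegral_mono fun x => ?_
        rw [← ENNReal.ofReal_mul (by positivity)]
        refine ENNReal.ofReal_le_ofReal ?_
        have h1 := hle x
        have h2 := apply_nonneg p x
        rcases le_total (p x) 1 with h3 | h3
        · rw [min_eq_left h3]
          exact (min_le_left _ _).trans (by nlinarith)
        · rw [min_eq_right h3]
          exact (min_le_right _ _).trans (by linarith)
    _ < ∞ := by
        rw [lintegral_const_mul' _ _ ENNReal.ofReal_ne_top]
        exact ENNReal.mul_lt_top ENNReal.ofReal_lt_top
          ((lintegral_min_seminorm_le α β hβ).trans_lt (by finiteness))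

theorem polarMeasure_singleton_zero (α : Measure (unitSphere p)) (β : unitSphere p → ℝ≥0)
    (hβ : Measurable β) : polarMeasure α β {0} = 0 := by
  rw [polarMeasure_apply α β hβ (measurableSet_singleton 0)]
  refine (lintegral_congr fun v => ?_).trans lintegral_zero
  refine (setLIntegral_congr_fun measurableSet_Ioi fun r hr => ?_).trans lintegral_zero
  have hv : p v = 1 := v.2
  have hv0 : (v : EuclideanSpace ℝ (Fin d)) ≠ 0 := fun h => by simp [h] at hv
  have hr0 : r ≠ 0 := ne_of_gt hr
  simp [hr0, hv0]

theorem isLevyMeasure_polarMeasure_iff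
    (hp : ∀ x : EuclideanSpace ℝ (Fin d), p x = 0 → x = 0)
    (α : Measure (unitSphere p)) [IsFiniteMeasure α] (β : unitSphere p → ℝ≥0)
    (hβ : Measurable β) :
    IsLevyMeasure (polarMeasure α β) ↔ logIntegral α β < ∞ := by
  refine ⟨fun h => ?_, fun h => ⟨polarMeasure_singleton_zero α β hβ,
    (lintegral_mono fun x => ENNReal.ofReal_le_ofReal ?_).trans_lt
      (lintegral_min_norm_lt_top hp α β hβ h)⟩⟩
  · obtain ⟨c, hc, hle⟩ := exists_le_norm_unitSphere p
    have hI := h.lintegral_lt_top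
    rw [lintegral_polarMeasure α β hβ (by fun_prop)] at hI
    calc logIntegral α β ≤ ∫⁻ v, (1 + ENNReal.ofReal (Real.exp 1 / min (c ^ 2) 1) *
          ∫⁻ r in Ioi (0 : ℝ),
            ENNReal.ofReal (min (‖r • (v : EuclideanSpace ℝ (Fin d))‖ ^ 2) 1) *
            ENNReal.ofReal (Real.exp (-(β v : ℝ) * r) / r)) ∂α := by
          refine lintegral_mono fun v => (logTerm_le_lintegral_min hc (β v)).trans ?_
          refine add_le_add le_rfl (mul_le_mul' le_rfl ?_)
          refine setLIntegral_mono' measurableSet_Ioi fun r hr => mul_le_mul' ?_ le_rfl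
          have hr0 : 0 < r := hr
          have := hle v
          refine ENNReal.ofReal_le_ofReal (min_le_min_right _ ?_)
          rw [norm_smul, Real.norm_of_nonneg hr0.le]
          gcongr
      _ < ∞ := by
          rw [lintegral_add_left measurable_const, lintegral_const_mul' _ _ ENNReal.ofReal_ne_top,
            lintegral_const]
          exact ENNReal.add_lt_top.2 ⟨by finiteness, ENNReal.mul_lt_top ENNReal.ofReal_lt_top hI⟩
  · rcases le_total ‖x‖ 1 with hx | hx
    · exact min_le_min_right _ (by nlinarith [norm_nonneg x])
    · rw [min_eq_right hx]
      exact min_le_right _ _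

theorem fourierIntegrand_eq_rayIntegrand (b : ℝ≥0) (v z : EuclideanSpace ℝ (Fin d)) :
    fourierIntegrand b v z = rayIntegrand b (inner ℝ v z) := rfl

theorem measurable_ofReal_exp_div {β : unitSphere p → ℝ≥0} (hβ : Measurable β) :
    Measurable (fun q : unitSphere p × ℝ =>
      ENNReal.ofReal (Real.exp (-(β q.1 : ℝ) * q.2) / q.2)) := by
  fun_prop

theorem toReal_smul_exp_sub_one_ae_eq (α : Measure (unitSphere p)) [IsFiniteMeasure α]
    (β : unitSphere p → ℝ≥0) (z : EuclideanSpace ℝ (Fin d)) :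
    (fun q : unitSphere p × ℝ =>
      (ENNReal.ofReal (Real.exp (-(β q.1 : ℝ) * q.2) / q.2)).toReal •
        (Complex.exp ((inner ℝ (q.2 • (q.1 : EuclideanSpace ℝ (Fin d))) z : ℝ) * Complex.I) - 1))
      =ᵐ[α.prod (volume.restrict (Ioi (0 : ℝ)))]
    fun q => fourierIntegrand (β q.1) (q.1 : EuclideanSpace ℝ (Fin d)) z q.2 := by
  filter_upwards [Measure.quasiMeasurePreserving_snd.ae (ae_restrict_mem measurableSet_Ioi)]
    with q hq
  have hq0 : 0 < q.2 := hq
  rw [ENNReal.toReal_ofReal (by positivity), fourierIntegrand, real_inner_smul_left,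
    Complex.real_smul, mul_comm _ Complex.I, mul_comm]

/-- Joint integrability on sphere times half-line is what Fubini needs to give both the inner and
the outer integrability. -/
theorem integrable_fourierIntegrand {α : Measure (unitSphere p)} [IsFiniteMeasure α]
    {β : unitSphere p → ℝ≥0} (hβ : Measurable β)
    (h : ∫⁻ x, ENNReal.ofReal (min ‖x‖ 1) ∂(polarMeasure α β) < ∞)
    (z : EuclideanSpace ℝ (Fin d)) :
    Integrable (fun q : unitSphere p × ℝ =>
      fourierIntegrand (β q.1) (q.1 : EuclideanSpace ℝ (Fin d)) z q.2)
      (α.prod (volume.restrict (Ioi (0 : ℝ)))) := by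
  have h1 := integrable_exp_inner_sub_one h z
  rw [polarMeasure, integrable_map_measure
    (measurable_exp_inner_sub_one z).aestronglyMeasurable (by fun_prop),
    integrable_withDensity_iff_integrable_smul' (measurable_ofReal_exp_div hβ)
    (Eventually.of_forall fun _ => ENNReal.ofReal_lt_top)] at h1
  exact h1.congr (toReal_smul_exp_sub_one_ae_eq α β z)

theorem jumpExponent_polarMeasure {α : Measure (unitSphere p)} [IsFiniteMeasure α]
    {β : unitSphere p → ℝ≥0} (hβ : Measurable β)
    (h : ∫⁻ x, ENNReal.ofReal (min ‖x‖ 1) ∂(polarMeasure α β) < ∞)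
    (z : EuclideanSpace ℝ (Fin d)) :
    jumpExponent (polarMeasure α β) z = ∫ v : unitSphere p, (∫ r in Ioi (0 : ℝ),
      fourierIntegrand (β v) (v : EuclideanSpace ℝ (Fin d)) z r) ∂α := by
  rw [jumpExponent, polarMeasure, integral_map (by fun_prop)
    (measurable_exp_inner_sub_one z).aestronglyMeasurable,
    integral_withDensity_eq_integral_toReal_smul (measurable_ofReal_exp_div hβ)
    (Eventually.of_forall fun _ => ENNReal.ofReal_lt_top),
    integral_congr_ae (toReal_smul_exp_sub_one_ae_eq α β z),
    integral_prod _ (integrable_fourierIntegrand hβ h z)]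

theorem exists_isGammaDistribution (hp : ∀ x : EuclideanSpace ℝ (Fin d), p x = 0 → x = 0)
    (α : Measure (unitSphere p)) [IsFiniteMeasure α] (β : unitSphere p → ℝ≥0)
    (hβ : Measurable β) (hlog : logIntegral α β < ∞) :
    ∃ μ : Measure (EuclideanSpace ℝ (Fin d)), IsGammaDistribution α β μ := by
  have h := lintegral_min_norm_lt_top hp α β hβ hlog
  obtain ⟨μ, hμ, hμc⟩ := exists_charFun_eq_exp_jumpExponent h
  refine ⟨μ, hμ, fun n hn => ?_, fun z => (integrable_fourierIntegrand hβ h z).prod_right_ae,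
    fun z => (integrable_fourierIntegrand hβ h z).integral_prod_left, fun z => ?_⟩
  · have hn0 : (n : ℝ≥0∞) ≠ 0 := by exact_mod_cast (Nat.one_le_iff_ne_zero.1 hn)
    obtain ⟨ρ, hρ, hρc⟩ := exists_charFun_eq_exp_jumpExponent
      (ν := (n : ℝ≥0∞)⁻¹ • polarMeasure α β) (by
        rw [lintegral_smul_measure]
        exact ENNReal.mul_lt_top (ENNReal.inv_lt_top.2 (pos_iff_ne_zero.2 hn0)) h)
    refine ⟨ρ, hρ, ?_⟩
    have := Measure.isProbabilityMeasure_map (μ := Measure.pi (fun _ : Fin n => ρ))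
      (f := fun x => ∑ i, x i) (by fun_prop)
    refine Measure.ext_of_charFun (funext fun z => ?_)
    rw [ProbabilityTheory.charFun_map_sum_pi_eq_prod, Finset.prod_apply, Finset.prod_const, hμc,
      hρc, ← Complex.exp_nat_mul, jumpExponent, jumpExponent, integral_smul_measure]
    have hn1 : (n : ℂ) ≠ 0 := by exact_mod_cast (Nat.one_le_iff_ne_zero.1 hn)
    simp [hn1]
  · rw [hμc, jumpExponent_polarMeasure hβ h]

/-- Expanding `∏ (1 + a i)` gives at least `1 + ∑ a i`. This passes from `|v|²` to the single
coordinates of `v`. -/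
theorem log_one_add_sum_le {ι : Type*} (s : Finset ι) {a : ι → ℝ} (ha : ∀ i, 0 ≤ a i) :
    Real.log (1 + ∑ i ∈ s, a i) ≤ ∑ i ∈ s, Real.log (1 + a i) := by
  classical
  induction s using Finset.induction_on with
  | empty => simp
  | insert i s hi ih =>
    have h0 : 0 ≤ ∑ j ∈ s, a j := Finset.sum_nonneg fun j _ => ha j
    have h1 := ha i
    rw [Finset.sum_insert hi, Finset.sum_insert hi]
    refine le_trans ?_ (add_le_add le_rfl ih)
    rw [← Real.log_mul (by positivity) (by positivity)]
    refine Real.log_le_log (by positivity) ?_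
    nlinarith [mul_nonneg h1 h0]

/-- The product of the two arguments contains `2 + 1/b²`, which exceeds `1 + 1/b`. -/
theorem log_one_add_inv_le {b c : ℝ} (hb : 0 < b) (hc : 0 < c) :
    Real.log (1 + 1 / b) ≤ Real.log (2 + 1 / c ^ 2) + Real.log (1 + c ^ 2 / b ^ 2) := by
  rw [← Real.log_mul (by positivity) (by positivity)]
  refine Real.log_le_log (by positivity) ?_
  have h1 : (2 + 1 / c ^ 2) * (1 + c ^ 2 / b ^ 2) =
      2 + 2 * (c ^ 2 / b ^ 2) + 1 / c ^ 2 + (1 / b) ^ 2 := by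
    field_simp
    ring
  have h2 : 0 ≤ c ^ 2 / b ^ 2 := by positivity
  have h3 : 0 ≤ 1 / c ^ 2 := by positivity
  rw [h1]
  nlinarith [sq_nonneg (1 / b - 1 / 2)]

theorem IsGammaDistribution.logIntegral_lt_top {α : Measure (unitSphere p)} [IsFiniteMeasure α]
    {β : unitSphere p → ℝ≥0} {μ : Measure (EuclideanSpace ℝ (Fin d))}
    (h : IsGammaDistribution α β μ) : logIntegral α β < ∞ := by
  obtain ⟨c, hc, hle⟩ := exists_le_norm_unitSphere p
  let e : Fin d → EuclideanSpace ℝ (Fin d) := fun j => EuclideanSpace.single j 1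
  have he : ∀ (v : EuclideanSpace ℝ (Fin d)) j, inner ℝ v (e j) = v j := fun v j => by
    simp [e, EuclideanSpace.inner_single_right]
  let G : Fin d → unitSphere p → ℂ := fun j v =>
    ∫ r in Ioi (0 : ℝ), fourierIntegrand (β v) (v : EuclideanSpace ℝ (Fin d)) (e j) r
  have hG : ∀ j, Integrable (G j) α := fun j => h.integrable_outer (e j)
  have hbound : Integrable (fun v => Real.log (2 + 1 / c ^ 2) + ∑ j, 2 * ‖G j v‖) α :=
    (integrable_const _).add (integrable_finsetSum _ fun j _ => (hG j).norm.const_mul 2)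
  refine lt_of_le_of_lt (lintegral_mono_ae ?_) hbound.lintegral_lt_top
  filter_upwards [ae_all_iff.2 fun j => h.integrable_inner (e j)] with v hv
  have hv0 : (v : EuclideanSpace ℝ (Fin d)) ≠ 0 := norm_pos_iff.1 (hc.trans_le (hle v))
  -- If `β v = 0`, integrability at every `e j` would force every coordinate of `v` to vanish.
  have hβ0 : β v ≠ 0 := fun h0 => hv0 <| by
    ext j
    by_contra hj
    have := hv j
    rw [fourierIntegrand_eq_rayIntegrand, h0, he] at this
    exact not_integrableOn_rayIntegrand_zero hj this
  have hb : (0 : ℝ) < β v := by exact_mod_cast pos_iff_ne_zero.2 hβ0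
  refine le_of_eq_of_le (logTerm_of_ne_zero hβ0) (ENNReal.ofReal_le_ofReal ?_)
  refine (log_one_add_inv_le hb hc).trans (add_le_add le_rfl ?_)
  have hsum : c ^ 2 / (β v : ℝ) ^ 2 ≤
      ∑ j, (v : EuclideanSpace ℝ (Fin d)) j ^ 2 / (β v : ℝ) ^ 2 := by
    rw [← Finset.sum_div, ← EuclideanSpace.real_norm_sq_eq]
    have := hle v
    gcongr
  refine (Real.log_le_log (by positivity) (add_le_add le_rfl hsum)).trans
    ((log_one_add_sum_le _ fun j => by positivity).trans (Finset.sum_le_sum fun j _ => ?_))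
  have hre := re_integral_rayIntegrand hb ((v : EuclideanSpace ℝ (Fin d)) j)
  have hnorm := (neg_le_abs _).trans (Complex.abs_re_le_norm (G j v))
  simp only [G, fourierIntegrand_eq_rayIntegrand, he] at hnorm ⊢
  rw [hre] at hnorm
  linarith

end Polar

end MultivariateGamma

theorem mainTheorem3 (d : ℕ) (p : Seminorm ℝ (EuclideanSpace ℝ (Fin d)))
    (hp : ∀ x : EuclideanSpace ℝ (Fin d), p x = 0 → x = 0)
    (α : MeasureTheory.Measure (MultivariateGamma.unitSphere p))
    [MeasureTheory.IsFiniteMeasure α]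
    (β : MultivariateGamma.unitSphere p → NNReal) (hβ : Measurable β) :
    (MultivariateGamma.IsLevyMeasure (MultivariateGamma.polarMeasure α β) ↔
        MultivariateGamma.logIntegral α β < ∞) ∧
      ((∃ μ : MeasureTheory.Measure (EuclideanSpace ℝ (Fin d)),
          MultivariateGamma.IsGammaDistribution α β μ) ↔
        MultivariateGamma.logIntegral α β < ∞) ∧
      (MultivariateGamma.logIntegral α β < ∞ →
        ∫⁻ x, ENNReal.ofReal (min (p x) 1) ∂(MultivariateGamma.polarMeasure α β) < ∞) :=
  ⟨MultivariateGamma.isLevyMeasure_polarMeasure_iff hp α β hβ,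
    ⟨fun ⟨_, hμ⟩ => hμ.logIntegral_lt_top,
      MultivariateGamma.exists_isGammaDistribution hp α β hβ⟩,
    fun h => (MultivariateGamma.lintegral_min_seminorm_le α β hβ).trans_lt (by finiteness)⟩
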